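/- For real $n>0$ let \[ I(n)=\int_0^1\bigl[x^n+(1-x)^n\bigr]^{1/n}\,dx . \] There is a sequence of real numbers $I_0,I_1,I_2,\dots$ such that \[ I(n)\sim I_0+\frac{I_1}{n}+\frac{I_2}{n^2}+\frac{I_3}{n^3}+\cdots\qquad (n\to\infty), \] that is, for every integer $N\ge 0$, $I(n)-\sum_{j=0}^N I_j n^{-j}=o(n^{-N})$ as $n\to\infty$ through the real numbers. The sequence is uniquely determined by this property, even if $n$ is only allowed to tend to infinity through the integers. For every $p\ge 2$ the coefficient $I_p$ is a polynomial with rational coefficients in the zeta values $\zeta(i)=\sum_{m\ge1}m^{-i}$, $i\ge 2$ an integer; that is, there is a polynomial $P_p$ with rational coefficients in finitely many of the variables $x_2,x_3,\dots$ such that $I_p=P_p(\zeta(2),\zeta(3),\dots)$. -/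

import Mathlib

open Filter Asymptotics

/-- The integral `I(n) = ∫₀¹ [xⁿ + (1 - x)ⁿ]^(1/n) dx`, for a real parameter `n`. -/
noncomputable def normIntegral (n : ℝ) : ℝ :=
  ∫ x in (0 : ℝ)..1, (x ^ n + (1 - x) ^ n) ^ (1 / n)

/-- `f(t) ~ c₀ + c₁ / t + c₂ / t² + ⋯` as `t` tends to infinity along the filter `l`, in the sense
of Poincaré: for every `N`, the error after the term `c_N / t ^ N` is `o(t ^ (-N))`.
The series itself is not required to converge. -/
def HasAsymptoticSeries (l : Filter ℝ) (f : ℝ → ℝ) (c : ℕ → ℝ) : Prop :=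
  ∀ N : ℕ, (fun t : ℝ => f t - ∑ j ∈ Finset.range (N + 1), c j / t ^ j) =o[l]
    (fun t : ℝ => (t ^ N)⁻¹)

/-- The filter of natural numbers tending to infinity, as a filter on `ℝ`. -/
def integersAtTop : Filter ℝ := Filter.map (fun m : ℕ => (m : ℝ)) Filter.atTop

/-- The complex number `z` is a polynomial with rational coefficients in (finitely many of) the
zeta values `ζ(i)`, `i ≥ 2`. -/
def IsRationalPolynomialInZetaValues (z : ℂ) : Prop :=
  ∃ P : MvPolynomial {i : ℕ // 2 ≤ i} ℚ,
    z = MvPolynomial.aeval (fun i : {i : ℕ // 2 ≤ i} => riemannZeta ((i : ℕ) : ℂ)) P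


/-!
The substitution `x = σ(s)`, where `σ` is the sigmoid function, and the evenness of the resulting
integrand give, with `w = σ² (1 - σ)`,
`I(n) = 2 ∫₀^∞ w(s) ds + (2 / n) ∫₀^∞ ((1 + e⁻ᵗ) ^ (1 / n) - 1) w(t / n) dt`.
Expanding both factors of the second integrand in powers of `1 / n` yields an asymptotic series
whose coefficients are rational combinations of the moments `∫₀^∞ tᵐ log(1 + e⁻ᵗ)ᵏ dt`. The single
moments need not be polynomials in zeta values, but `w(s)` is the product of `e^(s/2)` with an even
function, so only the combinations attached to `e^(s/2) s^i` with `i` even occur. These are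
generated by
`∫₀^∞ ((1 + e⁻ᵗ)⁻ʳ - 1) (e^(-b r t) + e^(-c r t)) dt`, where `b = 1/2 - y` and `c = 1/2 + y`.
As `b + c = 1`, this is the Beta integral `B(b r, c r)` minus its poles at `r = 0`, and
`b c r B(b r, c r) = Γ(1 + b r) Γ(1 + c r) / Γ(1 + r)` is the exponential of a power series in `r`
whose coefficients are rational polynomials in `y` and in zeta values `ζ(k)`, `k ≥ 2`.
Division by the monic polynomial `y² - 1/4` keeps the coefficients inside the algebra they generate.
-/

section RightExpansion

open PowerSeries Topology

/-- The power series `p`, which need not converge, is the asymptotic expansion of `f` as its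
argument tends to `0` from the right. -/
def HasRightExpansion (f : ℝ → ℝ) (p : PowerSeries ℝ) : Prop :=
  ∀ N : ℕ, (fun r : ℝ => f r - (trunc N p).eval r) =O[𝓝[>] 0] (fun r : ℝ => r ^ N)

theorem isBigO_eval_of_X_pow_dvd {P : Polynomial ℝ} {N : ℕ} (h : Polynomial.X ^ N ∣ P) :
    (fun r : ℝ => P.eval r) =O[𝓝[>] 0] (fun r : ℝ => r ^ N) := by
  obtain ⟨Q, rfl⟩ := h
  have hQ : (fun r : ℝ => Q.eval r) =O[𝓝[>] 0] (fun _ : ℝ => (1 : ℝ)) :=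
    ((Q.continuous.tendsto 0).isBigO_one ℝ).mono nhdsWithin_le_nhds
  simpa using (isBigO_refl (fun r : ℝ => r ^ N) (𝓝[>] 0)).mul hQ

theorem isBigO_pow_pow_nhdsGT_zero {m n : ℕ} (h : m ≤ n) :
    (fun r : ℝ => r ^ n) =O[𝓝[>] 0] (fun r : ℝ => r ^ m) := by
  simpa using isBigO_eval_of_X_pow_dvd (pow_dvd_pow (Polynomial.X : Polynomial ℝ) h)

theorem eval_trunc_eq_sum_range (p : PowerSeries ℝ) (N : ℕ) (r : ℝ) :
    (trunc N p).eval r = ∑ i ∈ Finset.range N, coeff i p * r ^ i :=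
  eval₂_trunc_eq_sum_range r (RingHom.id ℝ) N p

theorem constantCoeff_rescale {R : Type*} [CommSemiring R] (c : R) (p : PowerSeries R) :
    constantCoeff (rescale c p) = constantCoeff p := by
  rw [← coeff_zero_eq_constantCoeff_apply, coeff_rescale, pow_zero, one_mul,
    coeff_zero_eq_constantCoeff_apply]

theorem trunc_subst_eq_trunc_aeval {R : Type*} [CommRing R] {p : PowerSeries R}
    (hp : constantCoeff p = 0) (q : PowerSeries R) (N : ℕ) :
    trunc N (q.subst p) = trunc N (Polynomial.aeval p (trunc N q)) := by
  have hs : HasSubst p := HasSubst.of_constantCoeff_zero' hp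
  obtain ⟨u, hu⟩ : X ^ N ∣ p ^ N := pow_dvd_pow_of_dvd (X_dvd_iff.2 hp) N
  conv_lhs => rw [eq_X_pow_mul_shift_add_trunc N q]
  rw [subst_add hs, subst_mul hs, subst_pow hs, subst_X hs, subst_coe hs, hu, mul_assoc, map_add,
    trunc_X_pow_self_mul, zero_add]

namespace HasRightExpansion

variable {f g : ℝ → ℝ} {p q : PowerSeries ℝ}

theorem of_polynomial
    (h : ∀ N, ∃ P : Polynomial ℝ, trunc N (P : PowerSeries ℝ) = trunc N p ∧
      (fun r : ℝ => f r - P.eval r) =O[𝓝[>] 0] (fun r : ℝ => r ^ N)) :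
    HasRightExpansion f p := by
  intro N
  obtain ⟨P, hP, hf⟩ := h N
  have hdvd : Polynomial.X ^ N ∣ P - trunc N p := by
    rw [← hP, Polynomial.X_pow_dvd_iff]
    intro i hi
    simp [coeff_trunc, hi]
  refine (hf.add (isBigO_eval_of_X_pow_dvd hdvd)).congr_left fun r => ?_
  simp

theorem of_exists_ge (h : ∀ N, ∃ M ≥ N,
    (fun r : ℝ => f r - (trunc M p).eval r) =O[𝓝[>] 0] (fun r : ℝ => r ^ M)) :
    HasRightExpansion f p := by
  refine of_polynomial fun N => ?_
  obtain ⟨M, hM, h⟩ := h N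
  exact ⟨trunc M p, trunc_trunc_of_le p hM, h.trans (isBigO_pow_pow_nhdsGT_zero hM)⟩

theorem congr' (hf : HasRightExpansion f p) (h : f =ᶠ[𝓝[>] 0] g) : HasRightExpansion g p :=
  fun N => (hf N).congr' (h.mono fun r hr => by simp [hr]) EventuallyEq.rfl

theorem isBigO_one (hf : HasRightExpansion f p) : f =O[𝓝[>] 0] (fun _ : ℝ => (1 : ℝ)) := by
  simpa using hf 0

theorem tendsto (hf : HasRightExpansion f p) : Tendsto f (𝓝[>] 0) (𝓝 (constantCoeff p)) := by
  have hlim : Tendsto (fun r : ℝ => r ^ 1) (𝓝[>] 0) (𝓝 0) :=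
    ((continuous_pow 1).tendsto' 0 0 (zero_pow one_ne_zero)).mono_left nhdsWithin_le_nhds
  simpa [eval_trunc_eq_sum_range] using
    ((hf 1).trans_tendsto hlim).add_const (constantCoeff p)

theorem polynomial_eval (P : Polynomial ℝ) : HasRightExpansion (fun r => P.eval r) P :=
  of_polynomial fun _ => ⟨P, rfl, by simpa using isBigO_zero _ _⟩

theorem const (c : ℝ) : HasRightExpansion (fun _ => c) (C c) := by
  simpa using polynomial_eval (Polynomial.C c)

theorem id : HasRightExpansion (fun r => r) X := by
  simpa using polynomial_eval Polynomial.X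

theorem add (hf : HasRightExpansion f p) (hg : HasRightExpansion g q) :
    HasRightExpansion (fun r => f r + g r) (p + q) := fun N =>
  ((hf N).add (hg N)).congr_left fun r => by
    rw [map_add, Polynomial.eval_add]; ring

theorem mul (hf : HasRightExpansion f p) (hg : HasRightExpansion g q) :
    HasRightExpansion (fun r => f r * g r) (p * q) := by
  refine of_polynomial fun N => ⟨trunc N p * trunc N q, by simp, ?_⟩
  have h₁ := (hf N).mul hg.isBigO_one
  have h₂ := (polynomial_eval (trunc N p)).isBigO_one.mul (hg N)
  simp only [mul_one, one_mul] at h₁ h₂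
  refine (h₁.add h₂).congr_left fun r => ?_
  rw [Polynomial.eval_mul]
  ring

theorem const_mul (c : ℝ) (hf : HasRightExpansion f p) :
    HasRightExpansion (fun r => c * f r) (C c * p) := (const c).mul hf

theorem sub (hf : HasRightExpansion f p) (hg : HasRightExpansion g q) :
    HasRightExpansion (fun r => f r - g r) (p - q) := by
  simpa [sub_eq_add_neg] using hf.add (hg.const_mul (-1))

theorem polynomial_comp (P : Polynomial ℝ) (hf : HasRightExpansion f p) :
    HasRightExpansion (fun r => P.eval (f r)) (Polynomial.aeval p P) := by
  induction P using Polynomial.induction_on with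
  | C a => simpa using const a
  | add P Q hP hQ => simpa using hP.add hQ
  | monomial n a h => simpa [pow_succ, mul_assoc] using h.mul hf

theorem pow (hf : HasRightExpansion f p) (n : ℕ) :
    HasRightExpansion (fun r => f r ^ n) (p ^ n) := by
  simpa using hf.polynomial_comp (Polynomial.X ^ n)

theorem inv (hf : HasRightExpansion f p) (hp : constantCoeff p ≠ 0) :
    HasRightExpansion (fun r => (f r)⁻¹) p⁻¹ := by
  have hinv : (fun r => (f r)⁻¹) =O[𝓝[>] 0] (fun _ : ℝ => (1 : ℝ)) :=
    (hf.tendsto.inv₀ hp).isBigO_one ℝ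
  refine of_polynomial fun N => ⟨trunc N p⁻¹, trunc_trunc _, ?_⟩
  have hmul : (fun r => 1 - f r * (trunc N p⁻¹).eval r) =O[𝓝[>] 0] (fun r : ℝ => r ^ N) := by
    have htrunc : trunc N (p * (trunc N p⁻¹ : PowerSeries ℝ)) = trunc N 1 := by
      rw [← PowerSeries.mul_inv_cancel p hp, ← trunc_trunc_mul_trunc p p⁻¹,
        ← trunc_trunc_mul_trunc p (trunc N p⁻¹ : PowerSeries ℝ), trunc_trunc]
    have h := (hf.mul (polynomial_eval (trunc N p⁻¹))) N
    rw [htrunc] at h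
    simpa using (const 1 N).sub h
  refine (hinv.mul hmul).congr' ?_ (by simp)
  filter_upwards [hf.tendsto.eventually_ne hp] with r hr
  field_simp

theorem comp_const_mul (hf : HasRightExpansion f p) {c : ℝ} (hc : 0 < c) :
    HasRightExpansion (fun r => f (c * r)) (rescale c p) := by
  intro N
  have hlim : Tendsto (fun r : ℝ => c * r) (𝓝[>] 0) (𝓝[>] 0) :=
    tendsto_nhdsWithin_iff.2 ⟨((continuous_const_mul c).tendsto' 0 0 (mul_zero c)).mono_left
      nhdsWithin_le_nhds, by filter_upwards [self_mem_nhdsWithin] with r hr using mul_pos hc hr⟩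
  have hO : (fun r : ℝ => (c * r) ^ N) =O[𝓝[>] 0] (fun r : ℝ => r ^ N) :=
    ((isBigO_refl (fun r : ℝ => r) _).const_mul_left c).pow N
  refine (((hf N).comp_tendsto hlim).trans hO).congr_left fun r => ?_
  simp only [Function.comp_apply, eval_trunc_eq_sum_range, coeff_rescale, mul_pow]
  congr 1
  exact Finset.sum_congr rfl fun i _ => by ring

theorem comp_hasFPowerSeriesAt
    (hg : HasFPowerSeriesAt g (.ofScalars ℝ fun n => coeff n q) 0)
    (hf : HasRightExpansion f p) (hp : constantCoeff p = 0) :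
    HasRightExpansion (fun r => g (f r)) (q.subst p) := by
  intro N
  have hlim : Tendsto f (𝓝[>] 0) (𝓝 0) := by simpa [hp] using hf.tendsto
  have hO : f =O[𝓝[>] 0] (fun r : ℝ => r) := by simpa [hp, eval_trunc_eq_sum_range] using hf 1
  have htaylor : (fun s => g s - (trunc N q).eval s) =O[𝓝 0] (fun s : ℝ => s ^ N) := by
    have h := hg.isBigO_sub_partialSum_pow N
    simp only [← norm_pow, isBigO_norm_right, zero_add, FormalMultilinearSeries.partialSum,
      FormalMultilinearSeries.ofScalars_apply_eq, smul_eq_mul] at h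
    simpa only [eval_trunc_eq_sum_range] using h
  rw [trunc_subst_eq_trunc_aeval hp]
  refine (((htaylor.comp_tendsto hlim).trans (hO.pow N)).add
    (hf.polynomial_comp (trunc N q) N)).congr_left fun r => ?_
  simp

theorem exists_abs_sub_eval_trunc_le {S : Set ℝ} {B : ℝ} (hf : HasRightExpansion f p)
    (hS : ∀ s ∈ S, 0 < s) (hB : ∀ s ∈ S, |f s| ≤ B) (N : ℕ) :
    ∃ C, 0 ≤ C ∧ ∀ s ∈ S, |f s - (trunc N p).eval s| ≤ C * s ^ N := by
  obtain ⟨c, hc, hO⟩ := (hf N).exists_nonneg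
  obtain ⟨ε, hε : 0 < ε, hnear⟩ := mem_nhdsGT_iff_exists_Ioo_subset.1 (isBigOWith_iff.1 hO)
  set K := ∑ i ∈ Finset.range N, |coeff i p| * ε ^ i
  have : 0 ≤ K := by positivity
  refine ⟨c + (|B| + K) / ε ^ N, by positivity, fun s hs => ?_⟩
  have hs₀ := hS s hs
  rw [add_mul]
  rcases lt_or_ge s ε with hsε | hεs
  · have h : |_| ≤ c * |s ^ N| := hnear ⟨hs₀, hsε⟩
    rw [abs_of_pos (pow_pos hs₀ N)] at h
    exact h.trans (le_add_of_nonneg_right (by positivity))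
  · have hone : 1 ≤ s / ε := (one_le_div hε).2 hεs
    have hpoly : |(trunc N p).eval s| ≤ K * (s / ε) ^ N := by
      rw [eval_trunc_eq_sum_range, Finset.sum_mul]
      refine (Finset.abs_sum_le_sum_abs _ _).trans (Finset.sum_le_sum fun i hi => ?_)
      calc |coeff i p * s ^ i| = |coeff i p| * ε ^ i * (s / ε) ^ i := by
            rw [abs_mul, abs_of_pos (pow_pos hs₀ i), mul_assoc, ← mul_pow, mul_div_cancel₀ s hε.ne']
        _ ≤ |coeff i p| * ε ^ i * (s / ε) ^ N := by
            gcongr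
            exact (Finset.mem_range.1 hi).le
    calc |f s - (trunc N p).eval s| ≤ |f s| + |(trunc N p).eval s| := abs_sub _ _
      _ ≤ |B| * (s / ε) ^ N + K * (s / ε) ^ N := by
          gcongr
          exact ((hB s hs).trans (le_abs_self B)).trans
            (le_mul_of_one_le_right (abs_nonneg B) (one_le_pow₀ hone))
      _ = (|B| + K) / ε ^ N * s ^ N := by rw [div_pow]; ring
      _ ≤ c * s ^ N + (|B| + K) / ε ^ N * s ^ N := le_add_of_nonneg_left (by positivity)

theorem of_X_mul (hp : HasRightExpansion (fun r => r * f r) (X * p)) : HasRightExpansion f p := by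
  intro N
  have h := (hp (N + 1)).mul (isBigO_refl (fun r : ℝ => r⁻¹) (𝓝[>] 0))
  refine h.congr' ?_ ?_ <;> filter_upwards [self_mem_nhdsWithin] with r (hr : 0 < r)
  · rw [eval_trunc_eq_sum_range, eval_trunc_eq_sum_range, Finset.sum_range_succ']
    simp only [coeff_succ_X_mul, coeff_zero_X_mul, zero_mul, add_zero, pow_succ, ← mul_assoc,
      ← Finset.sum_mul]
    field_simp
  · rw [pow_succ, mul_inv_cancel_right₀ hr.ne']

theorem eq_zero (hp : HasRightExpansion (fun _ => 0) p) : p = 0 := by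
  ext d
  induction d generalizing p with
  | zero => simpa using (tendsto_nhds_unique tendsto_const_nhds hp.tendsto).symm
  | succ d ih =>
    have h₀ : constantCoeff p = 0 := (tendsto_nhds_unique tendsto_const_nhds hp.tendsto).symm
    obtain ⟨q, rfl⟩ := X_dvd_iff.2 h₀
    rw [coeff_succ_X_mul]
    exact ih (of_X_mul (by simpa using hp))

theorem unique (hp : HasRightExpansion f p) (hq : HasRightExpansion f q) : p = q := by
  have h := hp.sub hq
  simp only [sub_self] at h
  exact sub_eq_zero.1 h.eq_zero

end HasRightExpansion

theorem hasRightExpansion_exp_comp {f : ℝ → ℝ} {p : PowerSeries ℝ} (hf : HasRightExpansion f p)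
    (hp : constantCoeff p = 0) :
    HasRightExpansion (fun r => Real.exp (f r)) ((PowerSeries.exp ℝ).subst p) := by
  refine hf.comp_hasFPowerSeriesAt ?_ hp
  have h := NormedSpace.exp_hasFPowerSeriesAt_zero (𝕂 := ℝ) (𝔸 := ℝ)
  rw [← Real.exp_eq_exp_ℝ, NormedSpace.expSeries_eq_ofScalars] at h
  simpa [PowerSeries.coeff_exp] using h

theorem hasRightExpansion_exp_const_mul (c : ℝ) :
    HasRightExpansion (fun r => Real.exp (c * r)) (rescale c (PowerSeries.exp ℝ)) := by
  rw [rescale_eq_subst, smul_eq_C_mul]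
  exact hasRightExpansion_exp_comp (HasRightExpansion.id.const_mul c) (by simp)

theorem hasRightExpansion_log_one_add :
    HasRightExpansion (fun r => Real.log (1 + r)) (PowerSeries.log ℝ) := by
  have h := HasRightExpansion.id.comp_hasFPowerSeriesAt (g := fun x => Real.log (1 + x))
    (q := PowerSeries.log ℝ) ?_ (by simp)
  · simpa using h
  · convert hasFPowerSeriesAt_log_one_add using 2
    ext n
    rcases n with _ | n <;> simp [PowerSeries.coeff_log, pow_succ]

end RightExpansion


section Moments

open MeasureTheory PowerSeries Set Topology
open Finset (HasAntidiagonal)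
open Finset.HasAntidiagonal (antidiagonal)

/-- The moment `∫₀^∞ tᵐ ℓ(t)ᵏ dt`. -/
noncomputable def moment (ℓ : ℝ → ℝ) (k m : ℕ) : ℝ :=
  ∫ t in Ioi (0 : ℝ), t ^ m * ℓ t ^ k

/-- The asymptotic expansion, as `r → 0+`, of `∫₀^∞ F(r ℓ(t)) φ(r t) dt`, where `P` and `p` are the
expansions of `F` and `φ`. The constant coefficient of `P` is meant to vanish, since
`moment ℓ 0 m` is the junk value of a divergent integral. -/
noncomputable def momentSeries (ℓ : ℝ → ℝ) (P p : PowerSeries ℝ) : PowerSeries ℝ :=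
  mk fun d => ∑ x ∈ antidiagonal d, coeff x.1 P * coeff x.2 p * moment ℓ x.1 x.2

theorem coeff_momentSeries (ℓ : ℝ → ℝ) (P p : PowerSeries ℝ) (d : ℕ) :
    coeff d (momentSeries ℓ P p) =
      ∑ x ∈ antidiagonal d, coeff x.1 P * coeff x.2 p * moment ℓ x.1 x.2 :=
  coeff_mk _ _

theorem momentSeries_rescale (ℓ : ℝ → ℝ) (c : ℝ) (P p : PowerSeries ℝ) :
    momentSeries ℓ (rescale c P) (rescale c p) = rescale c (momentSeries ℓ P p) := by
  ext d
  simp only [coeff_momentSeries, coeff_rescale, Finset.mul_sum]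
  refine Finset.sum_congr rfl fun x hx => ?_
  rw [← HasAntidiagonal.mem_antidiagonal.1 hx, pow_add]
  ring

theorem coeff_momentSeries_mul (ℓ : ℝ → ℝ) (P p q : PowerSeries ℝ) (d : ℕ) :
    coeff d (momentSeries ℓ P (p * q)) =
      ∑ i ∈ Finset.range (d + 1), coeff i q * coeff d (momentSeries ℓ P (p * X ^ i)) := by
  simp only [coeff_momentSeries, Finset.mul_sum]
  rw [Finset.sum_comm]
  refine Finset.sum_congr rfl fun x hx => ?_
  have hx : x.2 ≤ d := by have := HasAntidiagonal.mem_antidiagonal.1 hx; omega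
  have hmul : coeff x.2 (p * q) =
      ∑ i ∈ Finset.range (d + 1), coeff i q * coeff x.2 (p * X ^ i) := by
    simp only [coeff_mul_X_pow', mul_ite, mul_zero]
    rw [← Finset.sum_filter, mul_comm p q, coeff_mul,
      Finset.Nat.sum_antidiagonal_eq_sum_range_succ (fun i j => coeff i q * coeff j p)]
    refine Finset.sum_congr ?_ fun _ _ => rfl
    ext i
    simp only [Finset.mem_filter, Finset.mem_range]
    omega
  rw [hmul, Finset.mul_sum, Finset.sum_mul]
  exact Finset.sum_congr rfl fun i _ => by ring

/-- The partial sums, over `k, m < N`, of the double series underlying `momentSeries ℓ P p`. -/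
noncomputable def momentPolynomial (ℓ : ℝ → ℝ) (P p : PowerSeries ℝ) (N : ℕ) : Polynomial ℝ :=
  ∑ k ∈ Finset.range N, ∑ m ∈ Finset.range N,
    Polynomial.monomial (k + m) (coeff k P * coeff m p * moment ℓ k m)

theorem trunc_momentPolynomial (ℓ : ℝ → ℝ) (P p : PowerSeries ℝ) {N M : ℕ} (h : N ≤ M) :
    trunc N (momentPolynomial ℓ P p M : PowerSeries ℝ) = trunc N (momentSeries ℓ P p) := by
  ext i
  rw [coeff_trunc, coeff_trunc]
  split_ifs with hi
  · rw [Polynomial.coeff_coe, coeff_momentSeries, momentPolynomial]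
    simp only [Polynomial.finsetSum_coeff, Polynomial.coeff_monomial]
    rw [← Finset.sum_product', ← Finset.sum_filter]
    refine Finset.sum_congr ?_ fun _ _ => rfl
    ext ⟨k, m⟩
    simp only [Finset.mem_filter, Finset.mem_product, Finset.mem_range,
      HasAntidiagonal.mem_antidiagonal]
    omega
  · rfl

variable {ℓ F φ : ℝ → ℝ} {P p : PowerSeries ℝ}

theorem integrableOn_pow_mul_pow (hℓ : Measurable ℓ) (hℓ₀ : ∀ t > 0, 0 < ℓ t)
    (hℓ₁ : ∀ t > 0, ℓ t ≤ 1) (hint : ∀ m : ℕ, IntegrableOn (fun t => t ^ m * ℓ t) (Ioi 0))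
    (m : ℕ) {k : ℕ} (hk : k ≠ 0) : IntegrableOn (fun t => t ^ m * ℓ t ^ k) (Ioi 0) := by
  refine (hint m).mono' (by fun_prop) ((ae_restrict_iff' measurableSet_Ioi).2 (ae_of_all _ ?_))
  intro t (ht : 0 < t)
  have := hℓ₀ t ht
  rw [Real.norm_of_nonneg (by positivity)]
  gcongr
  exact pow_le_of_le_one this.le (hℓ₁ t ht) hk

theorem eval_trunc_mul_eval_trunc (P p : PowerSeries ℝ) (N : ℕ) (r s t : ℝ) :
    (trunc N P).eval (r * s) * (trunc N p).eval (r * t) =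
      ∑ k ∈ Finset.range N, ∑ m ∈ Finset.range N,
        coeff k P * coeff m p * r ^ (k + m) * (t ^ m * s ^ k) := by
  rw [eval_trunc_eq_sum_range, eval_trunc_eq_sum_range, Finset.sum_mul_sum]
  exact Finset.sum_congr rfl fun k _ => Finset.sum_congr rfl fun m _ => by ring

section

variable (hk : ∀ m k : ℕ, k ≠ 0 → IntegrableOn (fun t => t ^ m * ℓ t ^ k) (Ioi 0))
  (hP : constantCoeff P = 0) (p)

include hk hP

theorem integrableOn_const_mul_pow_mul_pow (r : ℝ) (k m : ℕ) :
    IntegrableOn (fun t => coeff k P * coeff m p * r ^ (k + m) * (t ^ m * ℓ t ^ k)) (Ioi 0) := by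
  rcases eq_or_ne k 0 with rfl | h
  · simp [hP]
  · exact (hk m k h).const_mul _

theorem integrableOn_eval_trunc_mul_eval_trunc (N : ℕ) (r : ℝ) :
    IntegrableOn (fun t => (trunc N P).eval (r * ℓ t) * (trunc N p).eval (r * t)) (Ioi 0) := by
  simp only [eval_trunc_mul_eval_trunc]
  exact integrable_finsetSum _ fun k _ => integrable_finsetSum _ fun m _ =>
    integrableOn_const_mul_pow_mul_pow p hk hP r k m

theorem integral_eval_trunc_mul_eval_trunc (N : ℕ) (r : ℝ) :
    ∫ t in Ioi 0, (trunc N P).eval (r * ℓ t) * (trunc N p).eval (r * t) =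
      (momentPolynomial ℓ P p N).eval r := by
  have hint := integrableOn_const_mul_pow_mul_pow p hk hP r
  simp only [eval_trunc_mul_eval_trunc, momentPolynomial, Polynomial.eval_finsetSum,
    Polynomial.eval_monomial]
  rw [integral_finsetSum _ fun k _ => integrable_finsetSum _ fun m _ => hint k m]
  refine Finset.sum_congr rfl fun k _ => ?_
  rw [integral_finsetSum _ fun m _ => hint k m]
  refine Finset.sum_congr rfl fun m _ => ?_
  rw [integral_const_mul, moment]
  ring

end

theorem exists_abs_mul_sub_eval_trunc_le {A B : ℝ} (hF : HasRightExpansion F P)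
    (hFA : ∀ s ∈ Ioc 0 1, |F s| ≤ A) (hP : constantCoeff P = 0) (hφ : HasRightExpansion φ p)
    (hφB : ∀ s ∈ Ioi 0, |φ s| ≤ B) {N : ℕ} (hN : N ≠ 0) :
    ∃ C, ∀ r ∈ Ioc (0 : ℝ) 1, ∀ s ∈ Ioc (0 : ℝ) 1, ∀ t > 0,
      |F (r * s) * φ (r * t) - (trunc N P).eval (r * s) * (trunc N p).eval (r * t)| ≤
        C * (s + t ^ N * s) * r ^ N := by
  obtain ⟨C, hC, hFN⟩ := hF.exists_abs_sub_eval_trunc_le (fun s hs => hs.1) hFA N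
  obtain ⟨C₁, hC₁, hF₁⟩ := hF.exists_abs_sub_eval_trunc_le (fun s hs => hs.1) hFA 1
  obtain ⟨D, hD, hφN⟩ := hφ.exists_abs_sub_eval_trunc_le (fun s hs => hs) hφB N
  refine ⟨C * |B| + (C₁ + C) * D, fun r hr s hs t ht => ?_⟩
  obtain ⟨hr₀, hr₁⟩ := hr
  obtain ⟨hs₀, hs₁⟩ := hs
  have hrs : r * s ∈ Ioc (0 : ℝ) 1 := ⟨mul_pos hr₀ hs₀, mul_le_one₀ hr₁ hs₀.le hs₁⟩
  have hrt : r * t ∈ Ioi (0 : ℝ) := mul_pos hr₀ ht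
  set u := (trunc N P).eval (r * s)
  set v := (trunc N p).eval (r * t)
  have hFu : |F (r * s) - u| ≤ C * (r ^ N * s) := by
    refine (hFN _ hrs).trans ?_
    rw [mul_pow]
    gcongr
    exact pow_le_of_le_one hs₀.le hs₁ hN
  have hφv : |φ (r * t) - v| ≤ D * (r ^ N * t ^ N) := by simpa only [mul_pow] using hφN _ hrt
  have hu : |u| ≤ (C₁ + C) * s := by
    have h₁ : |F (r * s)| ≤ C₁ * (r * s) := by
      simpa [eval_trunc_eq_sum_range, hP] using hF₁ _ hrs
    calc |u| = |F (r * s) - (F (r * s) - u)| := by rw [sub_sub_cancel]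
      _ ≤ C₁ * (r * s) + C * (r ^ N * s) := (abs_sub _ _).trans (add_le_add h₁ hFu)
      _ ≤ C₁ * (1 * s) + C * (1 * s) := by gcongr; exact pow_le_one₀ hr₀.le hr₁
      _ = (C₁ + C) * s := by ring
  calc |F (r * s) * φ (r * t) - u * v|
      = |(F (r * s) - u) * φ (r * t) + u * (φ (r * t) - v)| := by ring_nf
    _ ≤ C * (r ^ N * s) * |B| + (C₁ + C) * s * (D * (r ^ N * t ^ N)) := by
        refine (abs_add_le _ _).trans ?_
        rw [abs_mul, abs_mul]
        gcongr ?_ * ?_ + ?_ * ?_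
        exact (hφB _ hrt).trans (le_abs_self B)
    _ = (C * |B| * s + (C₁ + C) * D * (t ^ N * s)) * r ^ N := by ring
    _ ≤ (C * |B| + (C₁ + C) * D) * (s + t ^ N * s) * r ^ N := by
        gcongr
        have h₁ : 0 ≤ C * |B| * (t ^ N * s) := by positivity
        have h₂ : 0 ≤ (C₁ + C) * D * s := by positivity
        linarith

theorem hasRightExpansion_integral_comp_mul {A B : ℝ} (hℓ : Measurable ℓ)
    (hℓ₀ : ∀ t > 0, 0 < ℓ t) (hℓ₁ : ∀ t > 0, ℓ t ≤ 1)
    (hint : ∀ m : ℕ, IntegrableOn (fun t => t ^ m * ℓ t) (Ioi 0))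
    (hF : HasRightExpansion F P) (hFm : Measurable F) (hFA : ∀ s ∈ Ioc 0 1, |F s| ≤ A)
    (hP : constantCoeff P = 0)
    (hφ : HasRightExpansion φ p) (hφm : Measurable φ) (hφB : ∀ s ∈ Ioi 0, |φ s| ≤ B) :
    HasRightExpansion (fun r => ∫ t in Ioi (0 : ℝ), F (r * ℓ t) * φ (r * t))
      (momentSeries ℓ P p) := by
  have hk : ∀ m k : ℕ, k ≠ 0 → IntegrableOn (fun t => t ^ m * ℓ t ^ k) (Ioi 0) :=
    fun m _ => integrableOn_pow_mul_pow hℓ hℓ₀ hℓ₁ hint m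
  refine HasRightExpansion.of_polynomial fun N =>
    ⟨momentPolynomial ℓ P p (N + 1), trunc_momentPolynomial ℓ P p N.le_succ, ?_⟩
  obtain ⟨C, hC⟩ := exists_abs_mul_sub_eval_trunc_le hF hFA hP hφ hφB N.succ_ne_zero
  set err := fun r t : ℝ => F (r * ℓ t) * φ (r * t) -
    (trunc (N + 1) P).eval (r * ℓ t) * (trunc (N + 1) p).eval (r * t)
  set bound := fun t : ℝ => C * (ℓ t + t ^ (N + 1) * ℓ t)
  have hbound : IntegrableOn bound (Ioi 0) := by
    have h := (hint 0).add (hint (N + 1))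
    simp only [pow_zero, one_mul] at h
    exact h.const_mul C
  have herr : ∀ r ∈ Ioc (0 : ℝ) 1, ∀ᵐ t ∂volume.restrict (Ioi 0),
      ‖err r t‖ ≤ bound t * r ^ (N + 1) := fun r hr =>
    (ae_restrict_iff' measurableSet_Ioi).2 (ae_of_all _ fun t ht =>
      hC r hr (ℓ t) ⟨hℓ₀ t ht, hℓ₁ t ht⟩ t ht)
  refine IsBigO.trans (IsBigO.of_bound (∫ t in Ioi (0 : ℝ), bound t) ?_)
    (isBigO_pow_pow_nhdsGT_zero N.le_succ)
  filter_upwards [Ioc_mem_nhdsGT one_pos] with r hr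
  have htrunc := integrableOn_eval_trunc_mul_eval_trunc p hk hP (N + 1) r
  have herr_int : IntegrableOn (err r) (Ioi 0) :=
    (hbound.mul_const (r ^ (N + 1))).mono' (by fun_prop) (herr r hr)
  have hsum : ∫ t in Ioi (0 : ℝ), F (r * ℓ t) * φ (r * t) =
      (∫ t in Ioi (0 : ℝ), err r t) + (momentPolynomial ℓ P p (N + 1)).eval r := by
    rw [← integral_eval_trunc_mul_eval_trunc p hk hP, ← integral_add herr_int htrunc]
    simp only [err, sub_add_cancel]
  rw [hsum, add_sub_cancel_right, Real.norm_of_nonneg (pow_nonneg hr.1.le (N + 1)),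
    ← integral_mul_const]
  exact norm_integral_le_of_norm_le (hbound.mul_const _) (herr r hr)

end Moments

section ZetaValues

open PowerSeries Topology

/-- The zeta value `ζ(k)` as a real number, for `k ≥ 2`. -/
noncomputable def realZeta (k : ℕ) : ℝ :=
  ∑' m : ℕ, 1 / ((m : ℝ) + 1) ^ k

theorem summable_one_div_succ_pow {k : ℕ} (hk : 2 ≤ k) :
    Summable (fun m : ℕ => 1 / ((m : ℝ) + 1) ^ k) := by
  simpa using (summable_nat_add_iff 1).2 (Real.summable_one_div_nat_pow.2 hk)

theorem ofReal_realZeta {k : ℕ} (hk : 2 ≤ k) : ((realZeta k : ℝ) : ℂ) = riemannZeta k := by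
  have hre : 1 < ((k : ℂ)).re := by simpa using Nat.lt_of_succ_le hk
  rw [zeta_eq_tsum_one_div_nat_add_one_cpow hre, realZeta, Complex.ofReal_tsum]
  simp

/-- The algebra of polynomials with rational coefficients in the zeta values `ζ(i)`, `i ≥ 2`. -/
noncomputable def zetaAlgebra : Subalgebra ℚ ℝ :=
  Algebra.adjoin ℚ (Set.range fun i : {i : ℕ // 2 ≤ i} => realZeta i)

theorem realZeta_mem_zetaAlgebra {k : ℕ} (hk : 2 ≤ k) : realZeta k ∈ zetaAlgebra :=
  Algebra.subset_adjoin ⟨⟨k, hk⟩, rfl⟩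

theorem isRationalPolynomialInZetaValues_of_mem_zetaAlgebra {x : ℝ} (hx : x ∈ zetaAlgebra) :
    IsRationalPolynomialInZetaValues x := by
  rw [zetaAlgebra, Algebra.adjoin_range_eq_range_aeval] at hx
  obtain ⟨P, rfl⟩ := hx
  have hzeta : (fun i : {i : ℕ // 2 ≤ i} => riemannZeta ((i : ℕ) : ℂ)) =
      fun i : {i : ℕ // 2 ≤ i} => algebraMap ℝ ℂ (realZeta i) :=
    funext fun i => (ofReal_realZeta i.2).symm
  refine ⟨P, ?_⟩
  rw [hzeta]
  exact (MvPolynomial.aeval_algebraMap_apply ℂ (fun i : {i : ℕ // 2 ≤ i} => realZeta i) P).symm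

/-- The asymptotic expansion of `∑ m, g (r / (m + 1))` as `r → 0+`, where `p` is the expansion of
`g`. The coefficients of `p` of degree less than `2` are meant to vanish. -/
noncomputable def zetaSeries (p : PowerSeries ℝ) : PowerSeries ℝ :=
  mk fun k => coeff k p * realZeta k

theorem hasSum_eval_trunc_div_succ {p : PowerSeries ℝ} (hp : X ^ 2 ∣ p) (N : ℕ) (r : ℝ) :
    HasSum (fun m : ℕ => (trunc N p).eval (r / (m + 1))) ((trunc N (zetaSeries p)).eval r) := by
  simp only [eval_trunc_eq_sum_range, zetaSeries, coeff_mk]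
  refine hasSum_sum fun k _ => ?_
  rcases lt_or_ge k 2 with hk | hk
  · simp [X_pow_dvd_iff.1 hp k hk]
  · have h := (summable_one_div_succ_pow hk).hasSum.mul_left (coeff k p * r ^ k)
    rw [← realZeta, mul_right_comm] at h
    refine h.congr_fun fun m => ?_
    rw [div_pow]
    ring

theorem hasRightExpansion_tsum_comp_div_succ {g : ℝ → ℝ} {p : PowerSeries ℝ}
    (hg : HasRightExpansion g p) (hp : X ^ 2 ∣ p) :
    HasRightExpansion (fun r => ∑' m : ℕ, g (r / (m + 1))) (zetaSeries p) := by
  refine HasRightExpansion.of_exists_ge fun N => ⟨N + 2, N.le_add_right 2, ?_⟩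
  obtain ⟨c, hO⟩ := (hg (N + 2)).bound
  obtain ⟨ε, hε : 0 < ε, hnear⟩ := mem_nhdsGT_iff_exists_Ioo_subset.1 hO
  refine IsBigO.of_bound (c * realZeta (N + 2)) ?_
  filter_upwards [Ioo_mem_nhdsGT hε] with r hr
  set err := fun m : ℕ => g (r / (m + 1)) - (trunc (N + 2) p).eval (r / (m + 1))
  have htrunc := hasSum_eval_trunc_div_succ hp (N + 2) r
  have hzeta := (summable_one_div_succ_pow (Nat.le_add_left 2 N)).hasSum.mul_left (c * r ^ (N + 2))
  have herr : ∀ m, ‖err m‖ ≤ c * r ^ (N + 2) * (1 / ((m : ℝ) + 1) ^ (N + 2)) := fun m => by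
    have hm : r / ((m : ℝ) + 1) ∈ Set.Ioo 0 ε :=
      ⟨div_pos hr.1 (by positivity), (div_le_self hr.1.le (by simp)).trans_lt hr.2⟩
    have h : ‖err m‖ ≤ c * ‖(r / ((m : ℝ) + 1)) ^ (N + 2)‖ := hnear hm
    rw [Real.norm_of_nonneg (pow_nonneg hm.1.le _), div_pow] at h
    exact h.trans_eq (by ring)
  have hsum : ∑' m : ℕ, g (r / (m + 1)) =
      ∑' m, err m + (trunc (N + 2) (zetaSeries p)).eval r := by
    rw [← htrunc.tsum_eq, ← (Summable.of_norm_bounded hzeta.summable herr).tsum_add htrunc.summable]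
    simp only [err, sub_add_cancel]
  rw [hsum, add_sub_cancel_right, Real.norm_of_nonneg (pow_nonneg hr.1.le (N + 2))]
  exact (tsum_of_norm_bounded hzeta herr).trans_eq (by rw [← realZeta]; ring)

end ZetaValues

section Gamma

open PowerSeries Topology

theorem sub_log_one_add_div_succ_nonneg {x : ℝ} (hx : 0 < x) (m : ℕ) :
    0 ≤ x / (m + 1) - Real.log (1 + x / (m + 1)) := by
  have := Real.log_le_sub_one_of_pos (x := 1 + x / (m + 1)) (by positivity)
  linarith

theorem sum_sub_log_one_add_div_succ {x : ℝ} (hx : 0 < x) (n : ℕ) :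
    ∑ m ∈ Finset.range n, (x / (m + 1) - Real.log (1 + x / (m + 1))) =
      Real.BohrMollerup.logGammaSeq x n + Real.log x + x * (harmonic n - Real.log n) := by
  have hlog : ∀ m : ℕ, Real.log (x + (m + 1 : ℕ)) =
      Real.log (m + 1) + Real.log (1 + x / (m + 1)) := fun m => by
    rw [← Real.log_mul (by positivity) (by positivity)]
    congr 1
    push_cast
    field_simp
    ring
  have hfactorial : Real.log n.factorial = ∑ m ∈ Finset.range n, Real.log ((m : ℝ) + 1) := by
    rw [← Real.log_prod fun m _ => by positivity, ← Finset.prod_range_add_one_eq_factorial]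
    push_cast
    rfl
  rw [Real.BohrMollerup.logGammaSeq, Finset.sum_range_succ', Finset.sum_congr rfl fun m _ => hlog m,
    Finset.sum_add_distrib, ← hfactorial, Finset.sum_sub_distrib, harmonic]
  push_cast
  simp only [div_eq_mul_inv, ← Finset.mul_sum, add_zero]
  ring

theorem log_Gamma_one_add_eq_tsum {x : ℝ} (hx : 0 < x) :
    Real.log (Real.Gamma (1 + x)) + Real.eulerMascheroniConstant * x =
      ∑' m : ℕ, (x / (m + 1) - Real.log (1 + x / (m + 1))) := by
  have hlim := ((Real.BohrMollerup.tendsto_log_gamma hx).add_const (Real.log x)).add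
    (Real.tendsto_harmonic_sub_log.const_mul x)
  have hsum := (hasSum_iff_tendsto_nat_of_nonneg (sub_log_one_add_div_succ_nonneg hx) _).2
    (hlim.congr fun n => (sum_sub_log_one_add_div_succ hx n).symm)
  rw [hsum.tsum_eq, add_comm 1 x, Real.Gamma_add_one hx.ne',
    Real.log_mul hx.ne' (Real.Gamma_pos_of_pos hx).ne']
  ring

/-- The expansion as `r → 0+` of `log Γ(1 + r) + γ r`, where `γ` is the Euler–Mascheroni
constant. -/
noncomputable def logGammaSeries : PowerSeries ℝ :=
  zetaSeries (X - PowerSeries.log ℝ)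

theorem X_pow_two_dvd_X_sub_log : X ^ 2 ∣ (X - PowerSeries.log ℝ : PowerSeries ℝ) := by
  refine X_pow_dvd_iff.2 fun k hk => ?_
  interval_cases k <;> simp [PowerSeries.coeff_log]

theorem constantCoeff_logGammaSeries : constantCoeff logGammaSeries = 0 := by
  rw [← coeff_zero_eq_constantCoeff_apply, logGammaSeries, zetaSeries, coeff_mk,
    X_pow_dvd_iff.1 X_pow_two_dvd_X_sub_log 0 two_pos, zero_mul]

theorem hasRightExpansion_log_Gamma_one_add :
    HasRightExpansion
      (fun r => Real.log (Real.Gamma (1 + r)) + Real.eulerMascheroniConstant * r)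
      logGammaSeries := by
  refine (hasRightExpansion_tsum_comp_div_succ
    (HasRightExpansion.id.sub hasRightExpansion_log_one_add) X_pow_two_dvd_X_sub_log).congr' ?_
  filter_upwards [self_mem_nhdsWithin] with r hr
  exact (log_Gamma_one_add_eq_tsum hr).symm

theorem coeff_logGammaSeries_mem_zetaAlgebra (k : ℕ) : coeff k logGammaSeries ∈ zetaAlgebra := by
  rw [logGammaSeries, zetaSeries, coeff_mk]
  rcases lt_or_ge k 2 with hk | hk
  · rw [X_pow_dvd_iff.1 X_pow_two_dvd_X_sub_log k hk, zero_mul]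
    exact zero_mem _
  · refine mul_mem ?_ (realZeta_mem_zetaAlgebra hk)
    rw [map_sub, coeff_X, if_neg (by omega), PowerSeries.coeff_log, if_neg (by omega), zero_sub]
    exact neg_mem (zetaAlgebra.algebraMap_mem _)

end Gamma

section Sigmoid

open MeasureTheory Set

/-- The function `-log σ(t) = log (1 + e⁻ᵗ)`, where `σ` is the sigmoid function. -/
noncomputable def negLogSigmoid (t : ℝ) : ℝ :=
  -Real.log (Real.sigmoid t)

theorem exp_mul_negLogSigmoid (r t : ℝ) :
    Real.exp (r * negLogSigmoid t) = Real.sigmoid t ^ (-r) := by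
  rw [Real.rpow_def_of_pos (Real.sigmoid_pos t), negLogSigmoid, mul_neg, mul_neg, mul_comm]

theorem continuous_negLogSigmoid : Continuous negLogSigmoid :=
  (continuous_sigmoid.log fun t => (Real.sigmoid_pos t).ne').neg

theorem negLogSigmoid_pos (t : ℝ) : 0 < negLogSigmoid t :=
  neg_pos.2 (Real.log_neg (Real.sigmoid_pos t) (Real.sigmoid_lt_one t))

theorem negLogSigmoid_le_exp_neg (t : ℝ) : negLogSigmoid t ≤ Real.exp (-t) := by
  have h := Real.log_le_sub_one_of_pos (inv_pos.2 (Real.sigmoid_pos t))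
  rwa [Real.log_inv, Real.sigmoid_def, inv_inv, add_sub_cancel_left, ← Real.sigmoid_def] at h

theorem negLogSigmoid_le_one {t : ℝ} (ht : 0 < t) : negLogSigmoid t ≤ 1 :=
  (negLogSigmoid_le_exp_neg t).trans (Real.exp_le_one_iff.2 (neg_nonpos.2 ht.le))

theorem integrableOn_pow_mul_exp_neg (m : ℕ) :
    IntegrableOn (fun t : ℝ => t ^ m * Real.exp (-t)) (Ioi 0) := by
  refine (Real.GammaIntegral_convergent (s := m + 1) (by positivity)).congr_fun (fun t _ => ?_)
    measurableSet_Ioi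
  simp [mul_comm]

theorem integrableOn_pow_mul_negLogSigmoid (m : ℕ) :
    IntegrableOn (fun t : ℝ => t ^ m * negLogSigmoid t) (Ioi 0) := by
  refine (integrableOn_pow_mul_exp_neg m).mono'
    ((continuous_pow m).mul continuous_negLogSigmoid).aestronglyMeasurable ?_
  refine (ae_restrict_iff' measurableSet_Ioi).2 (ae_of_all _ fun t (ht : 0 < t) => ?_)
  rw [Real.norm_of_nonneg (mul_nonneg (pow_nonneg ht.le m) (negLogSigmoid_pos t).le)]
  gcongr
  exact negLogSigmoid_le_exp_neg t

theorem hasRightExpansion_integral_exp_negLogSigmoid_sub_one_mul (c : ℝ) {φ : ℝ → ℝ}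
    {p : PowerSeries ℝ} {B : ℝ} (hφ : HasRightExpansion φ p) (hφm : Measurable φ)
    (hφB : ∀ s ∈ Ioi 0, |φ s| ≤ B) :
    HasRightExpansion
      (fun r => ∫ t in Ioi 0, (Real.exp (c * (r * negLogSigmoid t)) - 1) * φ (r * t))
      (momentSeries negLogSigmoid (PowerSeries.rescale c (PowerSeries.exp ℝ) - 1) p) := by
  have hF : HasRightExpansion (fun s => Real.exp (c * s) - 1)
      (PowerSeries.rescale c (PowerSeries.exp ℝ) - 1) := by
    simpa using (hasRightExpansion_exp_const_mul c).sub (HasRightExpansion.const 1)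
  refine hasRightExpansion_integral_comp_mul (A := Real.exp |c| + 1)
    continuous_negLogSigmoid.measurable (fun t _ => negLogSigmoid_pos t)
    (fun t ht => negLogSigmoid_le_one ht) integrableOn_pow_mul_negLogSigmoid hF (by fun_prop)
    (fun s hs => ?_) (by simp [constantCoeff_rescale]) hφ hφm hφB
  have hcs : c * s ≤ |c| :=
    (mul_le_mul_of_nonneg_right (le_abs_self c) hs.1.le).trans
      (mul_le_of_le_one_right (abs_nonneg c) hs.2)
  calc |Real.exp (c * s) - 1| ≤ |Real.exp (c * s)| + |1| := abs_sub _ _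
    _ = Real.exp (c * s) + 1 := by rw [Real.abs_exp, abs_one]
    _ ≤ Real.exp |c| + 1 := by gcongr

theorem intervalIntegral_eq_integral_sigmoid (f : ℝ → ℝ) :
    ∫ x in (0 : ℝ)..1, f x =
      ∫ s : ℝ, Real.sigmoid s * (1 - Real.sigmoid s) * f (Real.sigmoid s) := by
  rw [intervalIntegral.integral_of_le zero_le_one, integral_Ioc_eq_integral_Ioo,
    ← Real.range_sigmoid, ← image_univ,
    integral_image_eq_integral_abs_deriv_smul MeasurableSet.univ
      (fun x _ => (Real.hasDerivAt_sigmoid x).hasDerivWithinAt) Real.sigmoid_injective.injOn,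
    setIntegral_univ]
  refine integral_congr_ae (ae_of_all _ fun s => ?_)
  dsimp only
  rw [smul_eq_mul,
    abs_of_pos (mul_pos (Real.sigmoid_pos s) (sub_pos.2 (Real.sigmoid_lt_one s)))]

end Sigmoid

section Beta

open MeasureTheory Set PowerSeries Topology

theorem integral_eq_integral_Ioi_comp_neg_add {E : Type*} [NormedAddCommGroup E] [NormedSpace ℝ E]
    {f : ℝ → E} (hf : Integrable f) : ∫ s, f s = ∫ s in Ioi 0, (f (-s) + f s) := by
  rw [integral_add hf.comp_neg.integrableOn hf.integrableOn, integral_comp_neg_Ioi, neg_zero,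
    intervalIntegral.integral_Iic_add_Ioi hf.integrableOn hf.integrableOn]

theorem beta_eq_intervalIntegral {u v : ℝ} (hu : 0 < u) (hv : 0 < v) :
    ProbabilityTheory.beta u v = ∫ x in (0 : ℝ)..1, x ^ (u - 1) * (1 - x) ^ (v - 1) := by
  rw [ProbabilityTheory.beta_eq_betaIntegralReal u v hu hv, ← Complex.ofReal_re (∫ x in _.._, _),
    Complex.betaIntegral, ← intervalIntegral.integral_ofReal]
  congr 1
  refine intervalIntegral.integral_congr fun x hx => ?_
  rw [uIcc_of_le zero_le_one] at hx
  push_cast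
  rw [Complex.ofReal_cpow hx.1, Complex.ofReal_cpow (sub_nonneg.2 hx.2)]
  push_cast
  rfl

theorem integral_sigmoid_rpow_mul_sigmoid_neg_rpow {u v : ℝ} (hu : 0 < u) (hv : 0 < v) :
    ∫ s, Real.sigmoid s ^ u * Real.sigmoid (-s) ^ v = ProbabilityTheory.beta u v := by
  rw [beta_eq_intervalIntegral hu hv, intervalIntegral_eq_integral_sigmoid]
  refine integral_congr_ae (ae_of_all _ fun s => ?_)
  dsimp only
  rw [← Real.sigmoid_neg, mul_mul_mul_comm,
    ← Real.rpow_one_add' (Real.sigmoid_pos s).le (by simpa using hu.ne'),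
    ← Real.rpow_one_add' (Real.sigmoid_pos _).le (by simpa using hv.ne'), add_sub_cancel,
    add_sub_cancel]

theorem integrable_sigmoid_rpow_mul_sigmoid_neg_rpow {u v : ℝ} (hu : 0 < u) (hv : 0 < v) :
    Integrable (fun s => Real.sigmoid s ^ u * Real.sigmoid (-s) ^ v) :=
  .of_integral_ne_zero <| by
    rw [integral_sigmoid_rpow_mul_sigmoid_neg_rpow hu hv]
    exact (ProbabilityTheory.beta_pos hu hv).ne'

theorem sigmoid_rpow_mul_sigmoid_neg_rpow (u v s : ℝ) :
    Real.sigmoid s ^ u * Real.sigmoid (-s) ^ v =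
      Real.sigmoid s ^ (u + v) * Real.exp (-v * s) := by
  rw [← Real.sigmoid_mul_rexp_neg, Real.mul_rpow (Real.sigmoid_pos s).le (Real.exp_pos _).le,
    ← mul_assoc, ← Real.rpow_add (Real.sigmoid_pos s), ← Real.exp_mul, neg_mul_comm,
    mul_comm s]

/-- The exponentials subtracted here are the leading behaviour of the Beta integral at `±∞`. -/
theorem integral_sigmoid_rpow_sub_one_mul_exp_add_exp {u v : ℝ} (hu : 0 < u) (hv : 0 < v) :
    ∫ s in Ioi 0, (Real.sigmoid s ^ (u + v) - 1) * (Real.exp (-u * s) + Real.exp (-v * s)) =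
      ProbabilityTheory.beta u v - (u⁻¹ + v⁻¹) := by
  have hexp : ∀ z > 0, IntegrableOn (fun s => Real.exp (-z * s)) (Ioi 0) ∧
      ∫ s in Ioi 0, Real.exp (-z * s) = z⁻¹ := fun z hz =>
    ⟨integrableOn_exp_mul_Ioi (neg_neg_of_pos hz) 0, by
      rw [integral_exp_mul_Ioi (neg_neg_of_pos hz), mul_zero, Real.exp_zero, neg_div_neg_eq,
        one_div]⟩
  set f := fun s => Real.sigmoid s ^ u * Real.sigmoid (-s) ^ v
  have hf : Integrable f := integrable_sigmoid_rpow_mul_sigmoid_neg_rpow hu hv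
  calc _ = ∫ s in Ioi 0, ((f (-s) + f s) - (Real.exp (-u * s) + Real.exp (-v * s))) := by
        refine integral_congr_ae (ae_of_all _ fun s => ?_)
        simp only [f, neg_neg]
        rw [mul_comm (Real.sigmoid (-s) ^ u), sigmoid_rpow_mul_sigmoid_neg_rpow,
          sigmoid_rpow_mul_sigmoid_neg_rpow, add_comm v u]
        ring
    _ = (∫ s in Ioi 0, (f (-s) + f s)) - ∫ s in Ioi 0, (Real.exp (-u * s) + Real.exp (-v * s)) :=
        integral_sub (hf.comp_neg.integrableOn.add hf.integrableOn)
          ((hexp u hu).1.add (hexp v hv).1)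
    _ = _ := by
        rw [← integral_eq_integral_Ioi_comp_neg_add hf,
          integral_sigmoid_rpow_mul_sigmoid_neg_rpow hu hv,
          integral_add (hexp u hu).1 (hexp v hv).1, (hexp u hu).2, (hexp v hv).2]

theorem mul_integral_exp_negLogSigmoid_sub_one_mul {b c r : ℝ} (hb : 0 < b) (hc : 0 < c)
    (hbc : b + c = 1) (hr : 0 < r) :
    r * (b * c * ∫ t in Ioi 0, (Real.exp (-1 * (r * negLogSigmoid t)) - 1) *
        (Real.exp (-b * (r * t)) + Real.exp (-c * (r * t)))) =
      Real.Gamma (1 + b * r) * Real.Gamma (1 + c * r) / Real.Gamma (1 + r) - 1 := by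
  have hbr := mul_pos hb hr
  have hcr := mul_pos hc hr
  have hsum : b * r + c * r = r := by rw [← add_mul, hbc, one_mul]
  have h := integral_sigmoid_rpow_sub_one_mul_exp_add_exp hbr hcr
  rw [hsum, ProbabilityTheory.beta, hsum] at h
  simp only [← mul_assoc, neg_one_mul, exp_mul_negLogSigmoid, neg_neg, ← neg_mul] at h ⊢
  rw [h, add_comm 1, add_comm 1, add_comm 1, Real.Gamma_add_one hbr.ne', Real.Gamma_add_one hcr.ne',
    Real.Gamma_add_one hr.ne']
  have := (Real.Gamma_pos_of_pos hr).ne'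
  field_simp
  linear_combination -Real.Gamma r * hbc

/-- The expansion of `log (Γ(1 + b r) Γ(1 + c r) / Γ(1 + r))` as `r → 0+`, when `b + c = 1`. -/
noncomputable def logBetaSeries (b c : ℝ) : PowerSeries ℝ :=
  rescale b logGammaSeries + rescale c logGammaSeries - logGammaSeries

theorem hasRightExpansion_Gamma_mul_Gamma_div_Gamma {b c : ℝ} (hb : 0 < b) (hc : 0 < c)
    (hbc : b + c = 1) :
    HasRightExpansion
      (fun r => Real.Gamma (1 + b * r) * Real.Gamma (1 + c * r) / Real.Gamma (1 + r))
      ((PowerSeries.exp ℝ).subst (logBetaSeries b c)) := by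
  have hlog := ((hasRightExpansion_log_Gamma_one_add.comp_const_mul hb).add
    (hasRightExpansion_log_Gamma_one_add.comp_const_mul hc)).sub hasRightExpansion_log_Gamma_one_add
  have hconst : constantCoeff (logBetaSeries b c) = 0 := by
    simp [logBetaSeries, constantCoeff_rescale, constantCoeff_logGammaSeries]
  refine (hasRightExpansion_exp_comp hlog hconst).congr' ?_
  filter_upwards [self_mem_nhdsWithin] with r (hr : 0 < r)
  have hΓ : ∀ x > 0, 0 < Real.Gamma (1 + x * r) := fun x hx => Real.Gamma_pos_of_pos (by positivity)
  have hΓr : 0 < Real.Gamma (1 + r) := Real.Gamma_pos_of_pos (by positivity)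
  rw [← Real.exp_log (hΓ b hb), ← Real.exp_log (hΓ c hc), ← Real.exp_log hΓr, ← Real.exp_add,
    ← Real.exp_sub]
  simp only [Real.log_exp]
  congr 1
  linear_combination Real.eulerMascheroniConstant * r * hbc

theorem X_mul_momentSeries_exp_add_exp {b c : ℝ} (hb : 0 < b) (hc : 0 < c) (hbc : b + c = 1) :
    X * (C (b * c) * momentSeries negLogSigmoid (rescale (-1) (PowerSeries.exp ℝ) - 1)
        (rescale (-b) (PowerSeries.exp ℝ) + rescale (-c) (PowerSeries.exp ℝ))) =
      (PowerSeries.exp ℝ).subst (logBetaSeries b c) - 1 := by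
  have hmoments := hasRightExpansion_integral_exp_negLogSigmoid_sub_one_mul (-1)
    ((hasRightExpansion_exp_const_mul (-b)).add (hasRightExpansion_exp_const_mul (-c)))
    (by fun_prop) (B := 1 + 1) fun s (hs : 0 < s) => by
      rw [abs_of_pos (by positivity)]
      gcongr <;> rw [Real.exp_le_one_iff] <;> nlinarith
  have hbeta := (hasRightExpansion_Gamma_mul_Gamma_div_Gamma hb hc hbc).sub
    (HasRightExpansion.const 1)
  rw [map_one] at hbeta
  refine HasRightExpansion.unique
    ((HasRightExpansion.id.mul (hmoments.const_mul (b * c))).congr' ?_) hbeta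
  filter_upwards [self_mem_nhdsWithin] with r hr
  exact mul_integral_exp_negLogSigmoid_sub_one_mul hb hc hbc hr

end Beta

section EvenMoments

open PowerSeries

/-- The series `logGammaSeries` with its coefficients regarded as elements of `zetaAlgebra`. -/
noncomputable def logGammaZetaSeries : PowerSeries zetaAlgebra :=
  mk fun k => ⟨coeff k logGammaSeries, coeff_logGammaSeries_mem_zetaAlgebra k⟩

/-- The expansion of `log (Γ(1 + b r) Γ(1 + c r) / Γ(1 + r))` for `b = 1/2 - y` and `c = 1/2 + y`,
with coefficients regarded as polynomials in `y` over `zetaAlgebra`. -/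
noncomputable def logBetaPolynomialSeries : PowerSeries (Polynomial zetaAlgebra) :=
  rescale (algebraMap ℚ _ (1 / 2) - Polynomial.X)
      (PowerSeries.map Polynomial.C logGammaZetaSeries) +
    rescale (algebraMap ℚ _ (1 / 2) + Polynomial.X)
      (PowerSeries.map Polynomial.C logGammaZetaSeries) -
    PowerSeries.map Polynomial.C logGammaZetaSeries

theorem constantCoeff_logBetaPolynomialSeries : constantCoeff logBetaPolynomialSeries = 0 := by
  have h : coeff 0 logGammaZetaSeries = 0 := Subtype.ext <| by
    rw [logGammaZetaSeries, coeff_mk]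
    exact (coeff_zero_eq_constantCoeff_apply _).trans constantCoeff_logGammaSeries
  simp only [logBetaPolynomialSeries, ← coeff_zero_eq_constantCoeff_apply, map_sub, map_add,
    coeff_rescale, coeff_map, h, map_zero, mul_zero, add_zero, sub_zero]

theorem map_aeval_logBetaPolynomialSeries (y : ℝ) :
    PowerSeries.map (Polynomial.aeval (R := zetaAlgebra) y).toRingHom logBetaPolynomialSeries =
      logBetaSeries (1 / 2 - y) (1 / 2 + y) := by
  set φ := (Polynomial.aeval (R := zetaAlgebra) y).toRingHom
  have hX : φ Polynomial.X = y := Polynomial.aeval_X y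
  have hhalf : φ (algebraMap ℚ _ (1 / 2)) = 1 / 2 := by
    rw [RingHom.map_rat_algebraMap]
    norm_num
  have hL : PowerSeries.map φ (PowerSeries.map Polynomial.C logGammaZetaSeries) =
      logGammaSeries := by
    ext k
    rw [coeff_map, coeff_map, logGammaZetaSeries, coeff_mk]
    exact Polynomial.aeval_C y _
  simp only [logBetaPolynomialSeries, logBetaSeries, map_sub, map_add, ← rescale_map, hX, hhalf, hL]

theorem exists_aeval_eq_coeff_exp_subst_logBetaSeries (n : ℕ) :
    ∃ Q : Polynomial zetaAlgebra, ∀ y : ℝ,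
      coeff n ((PowerSeries.exp ℝ).subst (logBetaSeries (1 / 2 - y) (1 / 2 + y))) =
        Polynomial.aeval y Q := by
  refine ⟨coeff n ((PowerSeries.exp (Polynomial zetaAlgebra)).subst logBetaPolynomialSeries),
    fun y => ?_⟩
  have h := map_subst (h := (Polynomial.aeval (R := zetaAlgebra) y).toRingHom)
    (HasSubst.of_constantCoeff_zero' constantCoeff_logBetaPolynomialSeries)
    (PowerSeries.exp (Polynomial zetaAlgebra))
  rw [map_exp] at h
  rw [← map_aeval_logBetaPolynomialSeries]
  exact (congrArg (coeff n) h.symm).trans (coeff_map _ _ _)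

theorem rescale_exp_add_rescale_exp (a y : ℝ) :
    rescale (-(a - y)) (PowerSeries.exp ℝ) + rescale (-(a + y)) (PowerSeries.exp ℝ) =
      rescale (-1) (rescale a (PowerSeries.exp ℝ) *
        (rescale (-y) (PowerSeries.exp ℝ) + rescale y (PowerSeries.exp ℝ))) := by
  rw [mul_add, exp_mul_exp_eq_exp_add, exp_mul_exp_eq_exp_add, map_add, rescale_rescale,
    rescale_rescale, mul_neg_one, mul_neg_one, sub_eq_add_neg]

theorem coeff_momentSeries_exp_mul_exp_neg_add_exp {y : ℝ} (hy : y ∈ Set.Ioo (-(1 / 2)) (1 / 2))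
    (d : ℕ) :
    (1 / 2 - y) * (1 / 2 + y) * ((-1) ^ d * coeff d (momentSeries negLogSigmoid
        (PowerSeries.exp ℝ - 1) (rescale (1 / 2) (PowerSeries.exp ℝ) *
          (rescale (-y) (PowerSeries.exp ℝ) + rescale y (PowerSeries.exp ℝ))))) =
      coeff (d + 1) ((PowerSeries.exp ℝ).subst (logBetaSeries (1 / 2 - y) (1 / 2 + y))) := by
  have h := congrArg (coeff (d + 1)) (X_mul_momentSeries_exp_add_exp (b := 1 / 2 - y)
    (c := 1 / 2 + y) (sub_pos.2 hy.2) (neg_lt_iff_pos_add'.1 hy.1) (by ring))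
  rwa [coeff_succ_X_mul, coeff_C_mul, rescale_exp_add_rescale_exp,
    ← map_one (rescale (-1 : ℝ)), ← map_sub, momentSeries_rescale, coeff_rescale, map_one, map_sub,
    coeff_one, if_neg d.succ_ne_zero, sub_zero] at h

/-- The polynomial in `y` whose value is the coefficient of degree `d` in the moment series attached
to `E(s) (e⁻ʸˢ + eʸˢ)`. -/
noncomputable def evenMomentPolynomial (ℓ : ℝ → ℝ) (P E : PowerSeries ℝ) (d : ℕ) : Polynomial ℝ :=
  ∑ j ∈ Finset.range (d + 1), Polynomial.monomial j
    (((-1) ^ j + 1) / (j.factorial : ℝ) * coeff d (momentSeries ℓ P (E * X ^ j)))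

theorem eval_evenMomentPolynomial (ℓ : ℝ → ℝ) (P E : PowerSeries ℝ) (d : ℕ) (y : ℝ) :
    (evenMomentPolynomial ℓ P E d).eval y = coeff d (momentSeries ℓ P
      (E * (rescale (-y) (PowerSeries.exp ℝ) + rescale y (PowerSeries.exp ℝ)))) := by
  rw [coeff_momentSeries_mul, evenMomentPolynomial, Polynomial.eval_finsetSum]
  refine Finset.sum_congr rfl fun j _ => ?_
  rw [Polynomial.eval_monomial, map_add, coeff_rescale, coeff_rescale, coeff_exp, neg_pow, map_div₀,
    map_one, map_natCast]
  ring

theorem coeff_evenMomentPolynomial_of_even (ℓ : ℝ → ℝ) (P E : PowerSeries ℝ) {d i : ℕ}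
    (hi : Even i) (hid : i ≤ d) :
    (evenMomentPolynomial ℓ P E d).coeff i =
      2 / (i.factorial : ℝ) * coeff d (momentSeries ℓ P (E * X ^ i)) := by
  simp only [evenMomentPolynomial, Polynomial.finsetSum_coeff, Polynomial.coeff_monomial]
  rw [Finset.sum_ite_eq', if_pos (Finset.mem_range_succ_iff.2 hid), hi.neg_one_pow,
    one_add_one_eq_two]

theorem coeff_mem_of_monic_mul_eq_map {R S : Type*} [CommRing R] [CommRing S] [Algebra R S]
    {A : Subalgebra R S} {P : Polynomial S} {w q : Polynomial A} (hw : w.Monic)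
    (h : w.map (algebraMap A S) * P = q.map (algebraMap A S)) (i : ℕ) : P.coeff i ∈ A := by
  have hP : P = (q /ₘ w).map (algebraMap A S) := by
    rw [Polynomial.map_divByMonic _ hw, ← h, Polynomial.mul_divByMonic_cancel_left _ (hw.map _)]
  rw [hP, Polynomial.coeff_map]
  exact ((q /ₘ w).coeff i).2

theorem coeff_evenMomentPolynomial_mem_zetaAlgebra (d i : ℕ) :
    (evenMomentPolynomial negLogSigmoid (PowerSeries.exp ℝ - 1)
      (rescale (1 / 2) (PowerSeries.exp ℝ)) d).coeff i ∈ zetaAlgebra := by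
  set P := evenMomentPolynomial negLogSigmoid (PowerSeries.exp ℝ - 1)
    (rescale (1 / 2) (PowerSeries.exp ℝ)) d
  obtain ⟨Q, hQ⟩ := exists_aeval_eq_coeff_exp_subst_logBetaSeries (d + 1)
  set w : Polynomial zetaAlgebra := Polynomial.X ^ 2 - Polynomial.C (algebraMap ℚ _ (1 / 4))
  have hw : w.Monic := Polynomial.monic_X_pow_sub_C _ two_ne_zero
  refine coeff_mem_of_monic_mul_eq_map (q := (-1) ^ (d + 1) * Q) hw ?_ i
  refine Polynomial.eq_of_infinite_eval_eq _ _
    ((Set.Ioo_infinite (by norm_num : (-(1 / 2) : ℝ) < 1 / 2)).mono fun y hy => ?_)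
  have hPQ : (1 / 2 - y) * (1 / 2 + y) * ((-1) ^ d * P.eval y) = Polynomial.aeval y Q := by
    rw [← hQ, ← coeff_momentSeries_exp_mul_exp_neg_add_exp hy, eval_evenMomentPolynomial]
  have hw_eval : (w.map (algebraMap zetaAlgebra ℝ)).eval y = y ^ 2 - 1 / 4 := by
    rw [Polynomial.eval_map_algebraMap, map_sub, map_pow, Polynomial.aeval_X, Polynomial.aeval_C,
      RingHom.map_rat_algebraMap]
    norm_num
  have hsign : ((-1 : ℝ) ^ d) * (-1) ^ d = 1 := by rw [← mul_pow]; simp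
  rw [Set.mem_ofPred_eq, Polynomial.eval_mul, hw_eval, Polynomial.eval_map_algebraMap, map_mul,
    ← hPQ, map_pow, map_neg, map_one, pow_succ]
  linear_combination ((1 / 4 - y ^ 2) * P.eval y) * hsign

theorem coeff_momentSeries_exp_mul_X_pow_mem_zetaAlgebra {d i : ℕ} (hi : Even i) (hid : i ≤ d) :
    coeff d (momentSeries negLogSigmoid (PowerSeries.exp ℝ - 1)
      (rescale (1 / 2) (PowerSeries.exp ℝ) * X ^ i)) ∈ zetaAlgebra := by
  have h := zetaAlgebra.smul_mem (coeff_evenMomentPolynomial_mem_zetaAlgebra d i)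
    ((i.factorial : ℚ) / 2)
  rw [coeff_evenMomentPolynomial_of_even _ _ _ hi hid, Rat.smul_def, ← mul_assoc] at h
  push_cast at h
  rwa [div_mul_div_cancel₀ two_ne_zero, div_self (Nat.cast_ne_zero.2 i.factorial_ne_zero),
    one_mul] at h

end EvenMoments

section SigmoidWeight

open MeasureTheory Set PowerSeries

/-- The weight against which the substitution `x = σ(s)` turns `normIntegral` into an integral over
the half-line `s > 0`; there `σ(s)` is the larger of `x` and `1 - x`. -/
noncomputable def sigmoidWeight (s : ℝ) : ℝ :=
  Real.sigmoid s ^ 2 * Real.sigmoid (-s)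

theorem continuous_sigmoidWeight : Continuous sigmoidWeight :=
  (continuous_sigmoid.pow 2).mul (continuous_sigmoid.comp continuous_neg)

theorem sigmoidWeight_nonneg (s : ℝ) : 0 ≤ sigmoidWeight s :=
  mul_nonneg (sq_nonneg _) (Real.sigmoid_nonneg _)

theorem sigmoidWeight_le_exp_neg (s : ℝ) : sigmoidWeight s ≤ Real.exp (-s) := by
  rw [sigmoidWeight, ← Real.sigmoid_mul_rexp_neg, ← mul_assoc, ← pow_succ]
  exact mul_le_of_le_one_left (Real.exp_pos _).le
    (pow_le_one₀ (Real.sigmoid_nonneg s) (Real.sigmoid_le_one s))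

theorem integrableOn_sigmoidWeight : IntegrableOn sigmoidWeight (Ioi 0) := by
  refine (by simpa using integrableOn_pow_mul_exp_neg 0 :
    IntegrableOn (fun s : ℝ => Real.exp (-s)) (Ioi 0)).mono'
    continuous_sigmoidWeight.aestronglyMeasurable (ae_of_all _ fun s => ?_)
  rw [Real.norm_of_nonneg (sigmoidWeight_nonneg s)]
  exact sigmoidWeight_le_exp_neg s

theorem sigmoid_eq_exp_div (s : ℝ) :
    Real.sigmoid s =
      Real.exp (1 / 2 * s) / (Real.exp (1 / 2 * s) + Real.exp (-(1 / 2) * s)) := by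
  have h : Real.exp (-s) = Real.exp (-(1 / 2) * s) / Real.exp (1 / 2 * s) := by
    rw [← Real.exp_sub]
    ring_nf
  rw [Real.sigmoid_def, h]
  field_simp

theorem sigmoidWeight_eq_exp_mul_inv (s : ℝ) :
    sigmoidWeight s =
      Real.exp (1 / 2 * s) * ((Real.exp (1 / 2 * s) + Real.exp (-(1 / 2) * s)) ^ 3)⁻¹ := by
  have h : Real.exp (1 / 2 * s) * Real.exp (-(1 / 2) * s) = 1 := by
    rw [← Real.exp_add, ← Real.exp_zero]
    ring_nf
  rw [sigmoidWeight, sigmoid_eq_exp_div, sigmoid_eq_exp_div, mul_neg, neg_mul_neg, ← neg_mul,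
    add_comm (Real.exp (-(1 / 2) * s))]
  have hx := Real.exp_pos (1 / 2 * s)
  have hy := Real.exp_pos (-(1 / 2) * s)
  generalize Real.exp (1 / 2 * s) = x, Real.exp (-(1 / 2) * s) = y at h hx hy ⊢
  field_simp
  exact h

theorem map_inv_of_constantCoeff_ne_zero {k l : Type*} [Field k] [Field l]
    (f : PowerSeries k →+* PowerSeries l) {p : PowerSeries k} (hp : constantCoeff p ≠ 0) :
    f p⁻¹ = (f p)⁻¹ := by
  have h : f p⁻¹ * f p = 1 := by rw [← map_mul, PowerSeries.inv_mul_cancel p hp, map_one]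
  refine (PowerSeries.eq_inv_iff_mul_eq_one fun h0 => ?_).2 h
  simpa [h0] using congrArg constantCoeff h

theorem coeff_eq_zero_of_odd_of_rescale_neg_one {R : Type*} [CommRing R] [NoZeroDivisors R]
    [CharZero R] {p : PowerSeries R} (hp : rescale (-1) p = p) {i : ℕ} (hi : Odd i) :
    coeff i p = 0 := by
  have h := congrArg (coeff i) hp
  rwa [coeff_rescale, hi.neg_one_pow, neg_one_mul, neg_eq_self] at h

/-- The expansion of `e^(s/2) + e^(-s/2)`. -/
noncomputable def twoCoshSeries (k : Type*) [Field k] [Algebra ℚ k] : PowerSeries k :=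
  rescale (1 / 2) (PowerSeries.exp k) + rescale (-(1 / 2)) (PowerSeries.exp k)

theorem constantCoeff_twoCoshSeries_pow_ne_zero (k : Type*) [Field k] [Algebra ℚ k] (n : ℕ) :
    constantCoeff (twoCoshSeries k ^ n) ≠ 0 := by
  have := algebraRat.charZero k
  rw [map_pow, twoCoshSeries, map_add, constantCoeff_rescale, constantCoeff_rescale,
    constantCoeff_exp, one_add_one_eq_two]
  exact pow_ne_zero n two_ne_zero

theorem rescale_neg_one_twoCoshSeries (k : Type*) [Field k] [Algebra ℚ k] :
    rescale (-1) (twoCoshSeries k) = twoCoshSeries k := by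
  rw [twoCoshSeries, map_add, rescale_rescale, rescale_rescale, mul_neg_one, mul_neg_one, neg_neg,
    add_comm]

theorem map_twoCoshSeries {k l : Type*} [Field k] [Algebra ℚ k] [Field l] [Algebra ℚ l]
    (f : k →+* l) : PowerSeries.map f (twoCoshSeries k) = twoCoshSeries l := by
  rw [twoCoshSeries, map_add, ← rescale_map, ← rescale_map, map_exp, map_neg, map_div₀, map_one,
    map_ofNat, twoCoshSeries]

/-- The expansion of `sigmoidWeight` as `s → 0+`. -/
noncomputable def sigmoidWeightSeries : PowerSeries ℝ :=
  rescale (1 / 2) (PowerSeries.exp ℝ) * (twoCoshSeries ℝ ^ 3)⁻¹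

theorem hasRightExpansion_sigmoidWeight : HasRightExpansion sigmoidWeight sigmoidWeightSeries := by
  have hcosh := (hasRightExpansion_exp_const_mul (1 / 2)).add
    (hasRightExpansion_exp_const_mul (-(1 / 2)))
  refine (hasRightExpansion_exp_const_mul (1 / 2)).mul
    ((hcosh.pow 3).inv (constantCoeff_twoCoshSeries_pow_ne_zero ℝ 3)) |>.congr' ?_
  exact .of_forall fun s => (sigmoidWeight_eq_exp_mul_inv s).symm

theorem coeff_inv_twoCoshSeries_pow_of_odd (n : ℕ) {i : ℕ} (hi : Odd i) :
    coeff i (twoCoshSeries ℝ ^ n)⁻¹ = 0 := by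
  refine coeff_eq_zero_of_odd_of_rescale_neg_one ?_ hi
  rw [map_inv_of_constantCoeff_ne_zero _ (constantCoeff_twoCoshSeries_pow_ne_zero ℝ n), map_pow,
    rescale_neg_one_twoCoshSeries]

theorem coeff_inv_twoCoshSeries_pow_mem_zetaAlgebra (n i : ℕ) :
    coeff i (twoCoshSeries ℝ ^ n)⁻¹ ∈ zetaAlgebra := by
  rw [← map_twoCoshSeries (algebraMap ℚ ℝ), ← map_pow, ← map_inv_of_constantCoeff_ne_zero _
    (constantCoeff_twoCoshSeries_pow_ne_zero ℚ n), coeff_map]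
  exact zetaAlgebra.algebraMap_mem _

theorem coeff_momentSeries_sigmoidWeightSeries_mem_zetaAlgebra (d : ℕ) :
    coeff d (momentSeries negLogSigmoid (PowerSeries.exp ℝ - 1) sigmoidWeightSeries) ∈
      zetaAlgebra := by
  rw [sigmoidWeightSeries, coeff_momentSeries_mul]
  refine sum_mem fun i hi => ?_
  rcases i.even_or_odd with heven | hodd
  · exact mul_mem (coeff_inv_twoCoshSeries_pow_mem_zetaAlgebra 3 i)
      (coeff_momentSeries_exp_mul_X_pow_mem_zetaAlgebra heven (Finset.mem_range_succ_iff.1 hi))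
  · rw [coeff_inv_twoCoshSeries_pow_of_odd 3 hodd, zero_mul]
    exact zero_mem _

end SigmoidWeight

section NormIntegral

open MeasureTheory Set PowerSeries Topology

theorem sigmoid_rpow_add_sigmoid_neg_rpow_rpow {n : ℝ} (hn : n ≠ 0) (s : ℝ) :
    (Real.sigmoid s ^ n + Real.sigmoid (-s) ^ n) ^ (1 / n) =
      Real.sigmoid s * Real.exp (n⁻¹ * negLogSigmoid (n * s)) := by
  have hσ := Real.sigmoid_pos s
  have hσn := Real.sigmoid_pos (n * s)
  have hfactor : Real.sigmoid s ^ n + Real.sigmoid (-s) ^ n =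
      Real.sigmoid s ^ n * (Real.sigmoid (n * s))⁻¹ := by
    rw [← Real.sigmoid_mul_rexp_neg, Real.mul_rpow hσ.le (Real.exp_pos _).le, ← Real.exp_mul,
      Real.sigmoid_def (n * s), inv_inv]
    ring_nf
  rw [hfactor, exp_mul_negLogSigmoid, one_div,
    Real.mul_rpow (Real.rpow_nonneg hσ.le n) (inv_nonneg.2 hσn.le),
    Real.rpow_rpow_inv hσ.le hn, Real.inv_rpow hσn.le, Real.rpow_neg hσn.le]

theorem normIntegral_eq_integral_Ioi {n : ℝ} (hn : n ≠ 0) :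
    normIntegral n =
      2 * ∫ s in Ioi 0, Real.exp (n⁻¹ * negLogSigmoid (n * s)) * sigmoidWeight s := by
  set f : ℝ → ℝ := fun s => Real.sigmoid s * Real.sigmoid (-s) *
    (Real.sigmoid s ^ n + Real.sigmoid (-s) ^ n) ^ (1 / n)
  have heven : ∀ s, f |s| = f s := fun s => by
    rcases abs_choice s with h | h <;> simp only [h, f, neg_neg]
    rw [add_comm, mul_comm (Real.sigmoid (-s))]
  calc normIntegral n = ∫ s, f s := by
        simp only [normIntegral, intervalIntegral_eq_integral_sigmoid, ← Real.sigmoid_neg, f]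
    _ = ∫ s, f |s| := by simp only [heven]
    _ = 2 * ∫ s in Ioi 0, f s := integral_comp_abs
    _ = _ := by
        simp only [f, sigmoid_rpow_add_sigmoid_neg_rpow_rpow hn, sigmoidWeight]
        congr! 3
        ring

theorem integrableOn_exp_negLogSigmoid_sub_one_mul_sigmoidWeight {n : ℝ} (hn : 0 < n) :
    IntegrableOn (fun s => (Real.exp (n⁻¹ * negLogSigmoid (n * s)) - 1) * sigmoidWeight s)
      (Ioi 0) := by
  have := continuous_sigmoidWeight
  have := continuous_negLogSigmoid
  refine (integrableOn_sigmoidWeight.const_mul (Real.exp n⁻¹)).mono'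
    (Continuous.aestronglyMeasurable (by fun_prop))
    ((ae_restrict_iff' measurableSet_Ioi).2 (ae_of_all _ fun s (hs : 0 < s) => ?_))
  have hℓ := (negLogSigmoid_pos (n * s)).le
  have hone : 1 ≤ Real.exp (n⁻¹ * negLogSigmoid (n * s)) := Real.one_le_exp (by positivity)
  have hexp : Real.exp (n⁻¹ * negLogSigmoid (n * s)) ≤ Real.exp n⁻¹ :=
    Real.exp_le_exp.2
      (mul_le_of_le_one_right (inv_pos.2 hn).le (negLogSigmoid_le_one (mul_pos hn hs)))
  rw [Real.norm_of_nonneg (mul_nonneg (sub_nonneg.2 hone) (sigmoidWeight_nonneg s))]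
  exact mul_le_mul_of_nonneg_right (by linarith) (sigmoidWeight_nonneg s)

theorem normIntegral_eq_add {n : ℝ} (hn : 0 < n) :
    normIntegral n = 2 * (∫ s in Ioi 0, sigmoidWeight s) + 2 * (n⁻¹ *
      ∫ t in Ioi 0, (Real.exp (n⁻¹ * negLogSigmoid t) - 1) * sigmoidWeight (n⁻¹ * t)) := by
  have hscale := integral_comp_mul_left_Ioi
    (fun t => (Real.exp (n⁻¹ * negLogSigmoid t) - 1) * sigmoidWeight (n⁻¹ * t)) 0 hn
  simp only [mul_zero, smul_eq_mul, inv_mul_cancel_left₀ hn.ne'] at hscale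
  rw [normIntegral_eq_integral_Ioi hn.ne', ← hscale, ← mul_add, ← integral_add
    integrableOn_sigmoidWeight (integrableOn_exp_negLogSigmoid_sub_one_mul_sigmoidWeight hn)]
  congr! 3
  ring

/-- The asymptotic expansion of `normIntegral` in powers of `r = 1 / n`. -/
noncomputable def normIntegralSeries : PowerSeries ℝ :=
  C (2 * ∫ s in Ioi 0, sigmoidWeight s) +
    C 2 * (X * momentSeries negLogSigmoid (PowerSeries.exp ℝ - 1) sigmoidWeightSeries)

theorem hasRightExpansion_normIntegral_inv :
    HasRightExpansion (fun r => normIntegral r⁻¹) normIntegralSeries := by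
  have hmoments := hasRightExpansion_integral_exp_negLogSigmoid_sub_one_mul 1
    hasRightExpansion_sigmoidWeight continuous_sigmoidWeight.measurable (B := 1)
    fun s (hs : 0 < s) => by
      rw [abs_of_nonneg (sigmoidWeight_nonneg s)]
      exact (sigmoidWeight_le_exp_neg s).trans (Real.exp_le_one_iff.2 (neg_nonpos.2 hs.le))
  simp only [one_mul, rescale_one, RingHom.id_apply] at hmoments
  refine ((HasRightExpansion.const _).add
    ((HasRightExpansion.id.mul hmoments).const_mul 2)).congr' ?_
  filter_upwards [self_mem_nhdsWithin] with r hr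
  rw [normIntegral_eq_add (inv_pos.2 hr), inv_inv]

theorem coeff_succ_normIntegralSeries_mem_zetaAlgebra (d : ℕ) :
    coeff (d + 1) normIntegralSeries ∈ zetaAlgebra := by
  rw [normIntegralSeries, map_add, coeff_C, if_neg d.succ_ne_zero, zero_add, coeff_C_mul,
    coeff_succ_X_mul]
  exact mul_mem (ofNat_mem _ 2) (coeff_momentSeries_sigmoidWeightSeries_mem_zetaAlgebra d)

end NormIntegral

section AsymptoticSeries

open PowerSeries Topology

namespace HasAsymptoticSeries

theorem mono {l l' : Filter ℝ} {f : ℝ → ℝ} {c : ℕ → ℝ} (h : HasAsymptoticSeries l f c)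
    (hl : l' ≤ l) : HasAsymptoticSeries l' f c :=
  fun N => (h N).mono hl

theorem unique {l : Filter ℝ} [l.NeBot] (hl : l ≤ atTop) {f : ℝ → ℝ} {c c' : ℕ → ℝ}
    (h : HasAsymptoticSeries l f c) (h' : HasAsymptoticSeries l f c') : c = c' := by
  funext N
  induction N using Nat.strong_induction_on with
  | _ N ih =>
    have hne : ∀ᶠ t : ℝ in l, t ≠ 0 := (eventually_ne_atTop 0).filter_mono hl
    have hsub : (fun _ : ℝ => c' N - c N) =o[l] (fun _ : ℝ => (1 : ℝ)) := by
      refine (((h N).sub (h' N)).mul_isBigO (isBigO_refl (fun t : ℝ => t ^ N) l)).congr'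
        (hne.mono fun t ht => ?_) (hne.mono fun t ht => inv_mul_cancel₀ (pow_ne_zero N ht))
      have hsum : ∑ j ∈ Finset.range N, c j / t ^ j = ∑ j ∈ Finset.range N, c' j / t ^ j :=
        Finset.sum_congr rfl fun j hj => by rw [ih j (Finset.mem_range.1 hj)]
      simp only [Finset.sum_range_succ, hsum]
      field_simp
      ring
    exact (sub_eq_zero.1
      (tendsto_nhds_unique tendsto_const_nhds ((isLittleO_one_iff ℝ).1 hsub))).symm

end HasAsymptoticSeries

theorem HasRightExpansion.hasAsymptoticSeries_atTop {f : ℝ → ℝ} {p : PowerSeries ℝ}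
    (hf : HasRightExpansion (fun r => f r⁻¹) p) :
    HasAsymptoticSeries atTop f fun k => coeff k p := fun N => by
  have hpow : (fun t : ℝ => t⁻¹ ^ (N + 1)) =o[atTop] (fun t : ℝ => (t ^ N)⁻¹) := by
    refine (((isLittleO_one_iff ℝ).2 tendsto_inv_atTop_zero).mul_isBigO
      (isBigO_refl (fun t : ℝ => (t ^ N)⁻¹) atTop)).congr (fun t => ?_) (fun t => one_mul _)
    rw [pow_succ', inv_pow]
  refine (((hf (N + 1)).comp_tendsto tendsto_inv_atTop_nhdsGT_zero).trans_isLittleO hpow).congr_left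
    fun t => ?_
  simp only [Function.comp, inv_inv, eval_trunc_eq_sum_range, inv_pow, div_eq_mul_inv]

end AsymptoticSeries

theorem mainTheorem3 :
    ∃ I : ℕ → ℝ,
      HasAsymptoticSeries Filter.atTop normIntegral I ∧
      (∀ I' : ℕ → ℝ, HasAsymptoticSeries integersAtTop normIntegral I' → I' = I) ∧
      ∀ p : ℕ, 2 ≤ p → IsRationalPolynomialInZetaValues ((I p : ℝ) : ℂ) := by
  have hseries := hasRightExpansion_normIntegral_inv.hasAsymptoticSeries_atTop
  have hle : integersAtTop ≤ atTop := tendsto_natCast_atTop_atTop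
  have : integersAtTop.NeBot := map_neBot
  refine ⟨fun p => PowerSeries.coeff p normIntegralSeries, hseries,
    fun I' hI' => hI'.unique hle (hseries.mono hle), fun p hp => ?_⟩
  obtain ⟨d, rfl⟩ := Nat.exists_eq_add_of_le' (one_le_two.trans hp)
  exact isRationalPolynomialInZetaValues_of_mem_zetaAlgebra
    (coeff_succ_normIntegralSeries_mem_zetaAlgebra d)
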